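/- Let $d\ge 1$ be an odd integer and let $\sigma_1,\dots,\sigma_d$ be self-adjoint complex matrices of size $2^{(d-1)/2}$ satisfying $\sigma_i\sigma_j+\sigma_j\sigma_i=2\delta_{i,j}\mathbf 1$ for all $i,j$ (that is, generators of an irreducible representation of the complex Clifford algebra on $d$ generators), with the representation chosen such that $\sigma_1\sigma_2\cdots\sigma_d=(-\imath)^{\frac{d-1}{2}}\mathbf 1$. For $v\in\mathbb R^d$ write $v\cdot\sigma=\sum_{j=1}^d v_j\sigma_j$, and for $v\ne 0$ write $\widehat v=v/|v|$ with $|\cdot|$ the Euclidean norm. Let $x_1,\dots,x_{d+1}\in\mathbb R^d$ with $x_{d+1}=0$. Then the function $x\mapsto \mathrm{tr}\Big(\prod_{i=1}^d\big(\widehat{x_i+x}-\widehat{x_{i+1}+x}\big)\cdot\sigma\Big)$, which is defined for almost every $x \in \mathbb R^d$ (the product being taken in the order $i=1,\dots,d$, and $\mathrm{tr}$ being the trace of matrices), is Lebesgue integrable on $\mathbb R^d$, and $$ \int_{\mathbb R^d}\mathrm{tr}\Big(\prod_{i=1}^d\big(\widehat{x_i+x}-\widehat{x_{i+1}+x}\big)\cdot\sigma\Big)\,dx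 =\frac{2^d(-\imath\pi)^{\frac{d-1}{2}}}{d!!}\sum_{\rho\in S_d}(-1)^\rho\prod_{i=1}^d x_{i,\rho_i}, $$ where $x_{i,j}$ denotes the $j$-th component of $x_i$, and $(-1)^\rho$ the signature of $\rho$; the sum on the right is $\det(x_1,\dots,x_d)$. -/

import Mathlib

open MeasureTheory

/-- Self-adjoint generators `σ₁, …, σ_d` (with `d` odd) of an irreducible representation of the
complex Clifford algebra on `ℂ^{d'}`, `d' = 2 ^ ((d - 1) / 2)`, in the orientation for which
`σ₁ σ₂ ⋯ σ_d = (-i) ^ ((d - 1) / 2)`. Irreducibility need not be demanded: it is forced by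
the dimension `d'`. -/
structure IsCliffordGenerators (d : ℕ)
    (σ : Fin d → Matrix (Fin (2 ^ ((d - 1) / 2))) (Fin (2 ^ ((d - 1) / 2))) ℂ) : Prop where
  selfAdjoint : ∀ i, (σ i).IsHermitian
  anticomm : ∀ i j, σ i * σ j + σ j * σ i = if i = j then 2 else 0
  prod_eq : (List.ofFn σ).prod = (-Complex.I) ^ ((d - 1) / 2) • 1

/-- `v · σ = ∑ j, v_j σ_j`. -/
noncomputable def sigmaDot {d m : ℕ} (σ : Fin d → Matrix (Fin m) (Fin m) ℂ)
    (v : EuclideanSpace ℝ (Fin d)) : Matrix (Fin m) (Fin m) ℂ :=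
  ∑ j, (v j : ℂ) • σ j

/-- The integrand `tr_σ (∏_{i=1}^d (unit (x_i + y) - unit (x_{i+1} + y)) · σ)`, where
`unit v = v / |v|` and the product of matrices is taken in the order `i = 1, …, d`. -/
noncomputable def cliffordIntegrand {d m : ℕ} (σ : Fin d → Matrix (Fin m) (Fin m) ℂ)
    (x : Fin (d + 1) → EuclideanSpace ℝ (Fin d)) (y : EuclideanSpace ℝ (Fin d)) : ℂ :=
  (List.ofFn fun i : Fin d => sigmaDot σ
    (NormedSpace.normalize (x i.castSucc + y) - NormedSpace.normalize (x i.succ + y))).prod.trace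

/-! ### Clifford traces are determinants -/

section CliffordTrace

variable {A : Type*} [Ring A]

/-! The trace of `d` factors `v i · σ` is `(-2i)^((d-1)/2)` times `det v`: a word in the generators
that omits some `σ j` is traceless, and the other words are permutations of `σ₁ ⋯ σ_d`. Row
operations replace consecutive differences by differences with the last vector, so the problem is to
integrate `det (normalize (x i + y) - normalize y)` over `y`.

This is integrable: its rows are chords of length `O(1/|y|)` from one point of the unit sphere,
hence nearly tangent there, and the determinant is `O(|y|^{-(d+1)})`.

Expanding gives terms `det (normalize (x i + y))` of order only `|y|^{1-d}`, so a cutoff `φ(|s y|²)`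
is inserted. Each term is odd under reflection in a hyperplane through the points `-x i`; with the
cutoff centred at `-x i₀` its integral is therefore zero. Moving the centre to `0` costs a boundary
term, which after rescaling tends, as `s → 0`, to an isotropic second moment equal to `vol(B) det
x`. The other terms of the expansion have a zero vector among the `x i` and contribute nothing in
the limit. The volume of the odd-dimensional ball supplies `π` and `d!!`. -/

theorem prod_ofFn_comp_swap_of_anticommute {n : ℕ} (g : Fin (n + 1) → A) (i : Fin n)
    (h : g i.castSucc * g i.succ = -(g i.succ * g i.castSucc)) :
    (List.ofFn (g ∘ Equiv.swap i.castSucc i.succ)).prod = -(List.ofFn g).prod := by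
  induction n with
  | zero => exact i.elim0
  | succ n ih =>
    refine Fin.cases ?_ (fun i' => ?_) i (motive := fun i =>
      g i.castSucc * g i.succ = -(g i.succ * g i.castSucc) →
      (List.ofFn (g ∘ Equiv.swap i.castSucc i.succ)).prod = -(List.ofFn g).prod) h
    · intro h
      have h2 : ∀ k : Fin n, Equiv.swap (0 : Fin (n + 2)) 1 k.succ.succ = k.succ.succ := by
        intro k
        apply Equiv.swap_apply_of_ne_of_ne
        · exact Fin.succ_ne_zero _
        · rw [← Fin.succ_zero_eq_one]
          exact fun hk => Fin.succ_ne_zero _ (Fin.succ_injective _ hk)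
      have h' : g 0 * g 1 = -(g 1 * g 0) := by simpa using h
      simp only [Fin.castSucc_zero, Fin.succ_zero_eq_one, List.ofFn_succ, Function.comp_apply,
        List.prod_cons, h2, Equiv.swap_apply_left, Equiv.swap_apply_right]
      rw [← mul_assoc, ← mul_assoc, h', neg_mul, neg_neg]
    · intro h
      have h0 : Equiv.swap i'.succ.castSucc i'.succ.succ (0 : Fin (n + 2)) = 0 := by
        apply Equiv.swap_apply_of_ne_of_ne
        · rw [← Fin.succ_castSucc]; exact (Fin.succ_ne_zero _).symm
        · exact (Fin.succ_ne_zero _).symm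
      have hs : ∀ k : Fin (n + 1), Equiv.swap i'.succ.castSucc i'.succ.succ k.succ
          = (Equiv.swap i'.castSucc i'.succ k).succ := by
        intro k
        rw [← Fin.succ_castSucc]
        exact ((Fin.succ_injective _).swap_apply _ _ _)
      have := ih (fun k => g k.succ) i' (by simpa using h)
      simp only [Function.comp_def] at this
      simp only [List.ofFn_succ (n := n + 1), Function.comp_apply, List.prod_cons, h0, hs, this,
        mul_neg]

/-- Adjacent transpositions generate the symmetric group, and each costs one sign. -/
theorem prod_ofFn_comp_perm_of_anticommute {n : ℕ} (g : Fin n → A)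
    (h : ∀ i j, i ≠ j → g i * g j = -(g j * g i)) (τ : Equiv.Perm (Fin n)) :
    (List.ofFn (g ∘ τ)).prod = (Equiv.Perm.sign τ : ℤ) • (List.ofFn g).prod := by
  cases n with
  | zero => simp [Subsingleton.elim τ 1]
  | succ n =>
    have hτ : τ ∈ Submonoid.closure
        (Set.range fun i : Fin n => Equiv.swap i.castSucc i.succ) := by
      rw [Equiv.Perm.mclosure_swap_castSucc_succ]; trivial
    induction hτ using Submonoid.closure_induction_right with
    | one => simp
    | mul_right τ _ s hs ih =>
      obtain ⟨i, rfl⟩ := hs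
      have hne : i.castSucc ≠ i.succ := Fin.castSucc_lt_succ.ne
      rw [Equiv.Perm.coe_mul, ← Function.comp_assoc,
        prod_ofFn_comp_swap_of_anticommute _ _ 
          (h (τ i.castSucc) (τ i.succ) fun e => hne (τ.injective e)), ih]
      simp [Equiv.Perm.sign_swap hne]

theorem mul_list_prod_of_anticommute (a : A) (l : List A) (h : ∀ b ∈ l, a * b = -(b * a)) :
    a * l.prod = (-1) ^ l.length * (l.prod * a) := by
  induction l with
  | nil => simp
  | cons b l ih =>
    rw [List.prod_cons, ← mul_assoc, h b (by simp), neg_mul, mul_assoc,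
      ih fun c hc => h c (by simp [hc]), List.length_cons, pow_succ,
      ← mul_assoc b, ← ((Commute.neg_one_left b).pow_left l.length).eq]
    simp [mul_assoc]

theorem IsCliffordGenerators.sq {d : ℕ}
    {σ : Fin d → Matrix (Fin (2 ^ ((d - 1) / 2))) (Fin (2 ^ ((d - 1) / 2))) ℂ}
    (hσ : IsCliffordGenerators d σ) (i : Fin d) : σ i * σ i = 1 := by
  have h := hσ.anticomm i i
  rw [if_pos rfl, ← two_mul] at h
  have h2 : (2 : ℂ) • (σ i * σ i) = (2 : ℂ) • 1 := by
    rw [two_smul, two_smul, ← two_mul, h]; exact one_add_one_eq_two.symm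
  exact smul_right_injective _ (two_ne_zero' ℂ) h2

theorem IsCliffordGenerators.anticommute {d : ℕ}
    {σ : Fin d → Matrix (Fin (2 ^ ((d - 1) / 2))) (Fin (2 ^ ((d - 1) / 2))) ℂ}
    (hσ : IsCliffordGenerators d σ) {i j : Fin d} (h : i ≠ j) : σ i * σ j = -(σ j * σ i) := by
  have := hσ.anticomm i j
  rw [if_neg h] at this
  exact eq_neg_of_add_eq_zero_left this

/-- A generator `σ j` missing from the word anticommutes with each of its `d` letters. As `d` is
odd, conjugation by `σ j` negates the word, while preserving its trace. -/
theorem IsCliffordGenerators.trace_prod_eq_zero {d : ℕ} (hd : Odd d)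
    {σ : Fin d → Matrix (Fin (2 ^ ((d - 1) / 2))) (Fin (2 ^ ((d - 1) / 2))) ℂ}
    (hσ : IsCliffordGenerators d σ) (f : Fin d → Fin d) (hf : ¬ Function.Surjective f) :
    (List.ofFn (σ ∘ f)).prod.trace = 0 := by
  obtain ⟨j, hj⟩ := not_forall.mp hf
  have hj' : ∀ i, j ≠ f i := fun i e => hj ⟨i, e.symm⟩
  have key := mul_list_prod_of_anticommute (σ j) (List.ofFn (σ ∘ f)) (by
    intro b hb
    obtain ⟨i, rfl⟩ := (List.mem_ofFn' _ _).mp hb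
    exact hσ.anticommute (hj' i))
  rw [List.length_ofFn, hd.neg_one_pow, neg_one_mul] at key
  set P := (List.ofFn (σ ∘ f)).prod
  have h1 : P.trace = -P.trace := by
    calc P.trace = (P * (σ j * σ j)).trace := by rw [hσ.sq, mul_one]
      _ = (σ j * P * σ j).trace := by rw [← mul_assoc, Matrix.trace_mul_comm, ← mul_assoc]
      _ = -P.trace := by rw [key, neg_mul, mul_assoc, hσ.sq, mul_one, Matrix.trace_neg]
  exact self_eq_neg.mp h1

theorem IsCliffordGenerators.trace_prod_sigmaDot {d : ℕ} (hd : Odd d)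
    {σ : Fin d → Matrix (Fin (2 ^ ((d - 1) / 2))) (Fin (2 ^ ((d - 1) / 2))) ℂ}
    (hσ : IsCliffordGenerators d σ) (v : Fin d → EuclideanSpace ℝ (Fin d)) :
    (List.ofFn fun i => sigmaDot σ (v i)).prod.trace =
      (-2 * Complex.I) ^ ((d - 1) / 2) *
        (((Matrix.of fun i j => v i j : Matrix (Fin d) (Fin d) ℝ).det : ℝ) : ℂ) := by
  have hexp : (List.ofFn fun i => sigmaDot σ (v i)).prod
      = ∑ f : Fin d → Fin d, (∏ i, (v i (f i) : ℂ)) • (List.ofFn (σ ∘ f)).prod := by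
    rw [← MultilinearMap.mkPiAlgebraFin_apply (R := ℂ)]
    unfold sigmaDot
    rw [MultilinearMap.map_sum]
    refine Finset.sum_congr rfl fun f _ => ?_
    rw [MultilinearMap.map_smul_univ, MultilinearMap.mkPiAlgebraFin_apply]
    rfl
  have hperm : ∀ τ : Equiv.Perm (Fin d), (List.ofFn (σ ∘ τ)).prod.trace
      = (-2 * Complex.I) ^ ((d - 1) / 2) * ((Equiv.Perm.sign τ : ℤ) : ℂ) := by
    intro τ
    rw [prod_ofFn_comp_perm_of_anticommute σ (fun i j h => hσ.anticommute h), hσ.prod_eq,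
      Matrix.trace_smul, Matrix.trace_smul, Matrix.trace_one, zsmul_eq_mul]
    simp only [Fintype.card_fin, Nat.cast_pow, Nat.cast_ofNat, smul_eq_mul]
    rw [show (-2 * Complex.I) = 2 * (-Complex.I) by ring, mul_pow]
    ring
  rw [hexp, Matrix.trace_sum]
  simp_rw [Matrix.trace_smul, smul_eq_mul]
  rw [← Matrix.det_transpose, Matrix.det_apply', Complex.ofReal_sum, Finset.mul_sum]
  symm
  -- Only the bijective `f` survive in the sum over all maps.
  refine Finset.sum_of_injOn (fun τ : Equiv.Perm (Fin d) => (τ : Fin d → Fin d))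
    (fun a _ b _ h => DFunLike.coe_injective h) (by simp) ?_ ?_
  · intro f _ hf
    rw [hσ.trace_prod_eq_zero hd f, mul_zero]
    intro hs
    exact hf ⟨Equiv.ofBijective f (Finite.injective_iff_surjective.mpr hs |> fun h => ⟨h, hs⟩),
      by simp, rfl⟩
  · intro τ _
    rw [hperm]
    push_cast
    simp only [Matrix.transpose_apply, Matrix.of_apply]
    ring

end CliffordTrace

/-! ### Alternating maps and the determinant of vectors -/

section Alternating

/-- Terms with `y` in two slots vanish. The induction adds `y` to one more slot at a time. -/
theorem AlternatingMap.map_add_const {R M N ι : Type*} [CommRing R] [AddCommGroup M] [Module R M]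
    [AddCommGroup N] [Module R N] [Fintype ι] [DecidableEq ι] (f : M [⋀^ι]→ₗ[R] N)
    (x : ι → M) (y : M) :
    f (fun i => x i + y) = f x + ∑ j, f (Function.update x j y) := by
  have key : ∀ (S : Finset ι) (x : ι → M), f (fun i => if i ∈ S then x i + y else x i)
      = f x + ∑ j ∈ S, f (Function.update x j y) := by
    intro S
    induction S using Finset.induction_on with
    | empty => intro x; simp
    | insert j S hj ih =>
      intro x
      have e1 : (fun i => if i ∈ insert j S then x i + y else x i)
          = Function.update (fun i => if i ∈ S then x i + y else x i) j (x j + y) := by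
        ext i
        by_cases h : i = j
        · subst h; simp
        · simp [h]
      have e2 : Function.update (fun i => if i ∈ S then x i + y else x i) j (x j)
          = fun i => if i ∈ S then x i + y else x i := by
        ext i
        by_cases h : i = j
        · subst h; simp [hj]
        · simp [h]
      have e3 : Function.update (fun i => if i ∈ S then x i + y else x i) j y
          = fun i => if i ∈ S then Function.update x j y i + y else Function.update x j y i := by
        ext i
        by_cases h : i = j
        · subst h; simp [hj]
        · simp [h]
      have e4 : ∑ k ∈ S, f (Function.update (Function.update x j y) k y) = 0 := by
        refine Finset.sum_eq_zero fun k hk => ?_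
        have hkj : j ≠ k := fun e => hj (e ▸ hk)
        exact f.map_eq_zero_of_eq _ (by simp [hkj]) hkj
      rw [e1, f.map_update_add, e2, e3, ih, ih, e4, add_zero, Finset.sum_insert hj]
      abel
  simpa using key Finset.univ x

/-- The determinant of `d` vectors of `ℝ^d`, as an alternating map. -/
noncomputable def euclideanDet (d : ℕ) : EuclideanSpace ℝ (Fin d) [⋀^Fin d]→ₗ[ℝ] ℝ :=
  (Matrix.detRowAlternating (R := ℝ) (n := Fin d)).compLinearMap
    (EuclideanSpace.equiv (Fin d) ℝ).toLinearMap

theorem euclideanDet_apply {d : ℕ} (v : Fin d → EuclideanSpace ℝ (Fin d)) :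
    euclideanDet d v = (Matrix.of fun i j => v i j : Matrix (Fin d) (Fin d) ℝ).det := rfl

theorem euclideanDet_sub_succ {d : ℕ} (a : Fin (d + 1) → EuclideanSpace ℝ (Fin d)) :
    euclideanDet d (fun i => a i.castSucc - a i.succ) =
      euclideanDet d (fun i => a i.castSucc - a (Fin.last d)) := by
  cases d with
  | zero => exact congrArg _ (Subsingleton.elim _ _)
  | succ n =>
    -- Each difference with the last vector is a consecutive difference plus the next such row.
    -- Reversing the rows turns "next" into "previous", and both sides acquire the same sign.
    suffices h : euclideanDet (n + 1) ((fun i => a i.castSucc - a i.succ) ∘ Fin.revPerm) =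
        euclideanDet (n + 1) ((fun i => a i.castSucc - a (Fin.last (n + 1))) ∘ Fin.revPerm) by
      rw [AlternatingMap.map_perm, AlternatingMap.map_perm] at h
      exact smul_left_cancel _ h
    symm
    refine Matrix.det_eq_of_forall_row_eq_smul_add_pred (fun _ => 1) ?_ ?_
    · intro j
      simp
    · intro i j
      have h1 : (Fin.rev i.succ).succ = (Fin.rev i.castSucc).castSucc := by
        ext; simp [Fin.val_rev]; omega
      simp [h1]

end Alternating

/-! ### Integrability from nearly tangent chords -/

section DetNormalize

open NormedSpace

theorem norm_normalize_le_one {V : Type*} [NormedAddCommGroup V] [NormedSpace ℝ V] (v : V) :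
    ‖normalize v‖ ≤ 1 := by
  by_cases h : v = 0
  · simp [h]
  · exact (norm_normalize_eq_one_iff.mpr h).le

theorem norm_normalize_sub_normalize_mul_le {V : Type*} [NormedAddCommGroup V] [NormedSpace ℝ V]
    (a b : V) : ‖normalize a - normalize b‖ * ‖b‖ ≤ 2 * ‖a - b‖ := by
  have h : ‖b‖ • (normalize a - normalize b) = (‖b‖ - ‖a‖) • normalize a + (a - b) := by
    rw [smul_sub, sub_smul, norm_smul_normalize, norm_smul_normalize]; abel
  calc ‖normalize a - normalize b‖ * ‖b‖ = ‖‖b‖ • (normalize a - normalize b)‖ := by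
        rw [norm_smul, norm_norm, mul_comm]
    _ ≤ ‖‖b‖ - ‖a‖‖ * ‖normalize a‖ + ‖a - b‖ := by
        rw [h]; exact (norm_add_le _ _).trans_eq (by rw [norm_smul])
    _ ≤ ‖a - b‖ * 1 + ‖a - b‖ := by
        gcongr
        · rw [norm_sub_rev a b]; exact abs_norm_sub_norm_le b a
        · exact norm_normalize_le_one a
    _ = 2 * ‖a - b‖ := by ring

variable {d : ℕ}

theorem continuous_euclideanDet :
    Continuous fun v : Fin d → EuclideanSpace ℝ (Fin d) => euclideanDet d v := by
  simp only [euclideanDet_apply]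
  refine Continuous.matrix_det ?_
  refine continuous_matrix fun i j => ?_
  simp only [Matrix.of_apply]
  fun_prop

theorem abs_euclideanDet_le {K : ℝ} (v : Fin d → EuclideanSpace ℝ (Fin d))
    (h : ∀ i, ‖v i‖ ≤ K) : |euclideanDet d v| ≤ d.factorial * K ^ d := by
  have := Matrix.det_le (A := Matrix.of fun i j => v i j) (abv := AbsoluteValue.abs) (x := K)
    fun i j => (PiLp.norm_apply_le (v i) j).trans (h i)
  simpa [euclideanDet_apply] using this

/-- If the chord vectors `v i = a i - b` join a unit vector `b` to unit vectors, then
`⟪v i, b⟫` is quadratic in `v i`, so their determinant has one order more than expected. -/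
theorem abs_euclideanDet_le_of_chords {K : ℝ} (hK : 0 < K)
    (v : Fin d → EuclideanSpace ℝ (Fin d)) (b : EuclideanSpace ℝ (Fin d)) (hb : ‖b‖ = 1)
    (hv : ∀ i, ‖v i + b‖ = 1) (h : ∀ i, ‖v i‖ ≤ K) :
    |euclideanDet d v| ≤ d * (d.factorial * K ^ (d + 1)) := by
  set V : Matrix (Fin d) (Fin d) ℝ := Matrix.of fun i j => v i j with hV
  have hw : ∀ i, |(V.mulVec (b : Fin d → ℝ)) i| ≤ K * K := by
    intro i
    have h1 : (V.mulVec (b : Fin d → ℝ)) i = inner ℝ (v i) b := by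
      simp [Matrix.mulVec, dotProduct, hV, PiLp.inner_apply, mul_comm]
    have h2 := norm_add_sq_real (v i) b
    rw [hv, hb] at h2
    have h3 : inner ℝ (v i) b = -(‖v i‖ ^ 2 / 2) := by linarith
    rw [h1, h3, abs_neg, abs_of_nonneg (by positivity)]
    nlinarith [h i, norm_nonneg (v i)]
  -- Cramer's rule: `det V * b k` is the determinant of `V` with column `k` replaced by `V b`, whose
  -- entries are at most `K²`. Extracting one factor `K` leaves a matrix with entries at most `K`.
  have hcol : ∀ k, |V.det * b k| ≤ d.factorial * K ^ (d + 1) := by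
    intro k
    have e1 : V.det * b k = (V.updateCol k (V.mulVec (b : Fin d → ℝ))).det := by
      rw [← Matrix.cramer_apply, Matrix.cramer_eq_adjugate_mulVec, Matrix.mulVec_mulVec,
        Matrix.adjugate_mul, Matrix.smul_mulVec, Matrix.one_mulVec]
      rfl
    have e2 : V.mulVec (b : Fin d → ℝ) = K • (K⁻¹ • V.mulVec (b : Fin d → ℝ)) := by
      rw [smul_inv_smul₀ hK.ne']
    have e3 := Matrix.det_le (A := V.updateCol k (K⁻¹ • V.mulVec (b : Fin d → ℝ)))
      (abv := AbsoluteValue.abs) (x := K) (by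
        intro i j
        rw [Matrix.updateCol_apply]
        split_ifs
        · rw [Pi.smul_apply, smul_eq_mul, AbsoluteValue.abs_apply, abs_mul, abs_inv,
            abs_of_pos hK, inv_mul_le_iff₀ hK]
          exact hw i
        · exact (PiLp.norm_apply_le (v i) j).trans (h i))
    rw [e1, e2, Matrix.det_updateCol_smul, abs_mul, abs_of_pos hK]
    simp only [AbsoluteValue.abs_apply, Fintype.card_fin, nsmul_eq_mul] at e3
    calc _ ≤ K * (d.factorial * K ^ d) := by gcongr
      _ = _ := by ring
  have hbk : ∀ k, |b k| ≤ 1 := fun k => (PiLp.norm_apply_le b k).trans hb.le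
  have hsum : ∑ k, b k * b k = 1 := by
    have := EuclideanSpace.real_norm_sq_eq b
    rw [hb, one_pow] at this
    rw [this]; exact Finset.sum_congr rfl fun k _ => (sq _).symm
  calc |euclideanDet d v| = |∑ k, V.det * b k * b k| := by
        rw [euclideanDet_apply]; simp_rw [mul_assoc]; rw [← Finset.mul_sum, hsum, mul_one]
    _ ≤ ∑ k, |V.det * b k * b k| := Finset.abs_sum_le_sum_abs _ _
    _ ≤ ∑ _k : Fin d, d.factorial * K ^ (d + 1) := by
        refine Finset.sum_le_sum fun k _ => ?_
        rw [abs_mul]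
        exact (mul_le_of_le_one_right (abs_nonneg _) (hbk k)).trans (hcol k)
    _ = _ := by simp

theorem measurable_euclideanDet_normalize_sub
    (x z : Fin d → EuclideanSpace ℝ (Fin d)) :
    Measurable fun y => euclideanDet d fun i => normalize (x i + y) - normalize (z i + y) := by
  refine continuous_euclideanDet.measurable.comp (measurable_pi_lambda _ fun i => ?_)
  unfold NormedSpace.normalize
  fun_prop

theorem measurable_euclideanDet_normalize (x : Fin d → EuclideanSpace ℝ (Fin d)) :
    Measurable fun y => euclideanDet d fun i => normalize (x i + y) := by
  refine continuous_euclideanDet.measurable.comp (measurable_pi_lambda _ fun i => ?_)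
  unfold NormedSpace.normalize
  fun_prop

theorem integrable_euclideanDet_normalize_sub (hd : 0 < d)
    (x : Fin d → EuclideanSpace ℝ (Fin d)) :
    Integrable (fun y => euclideanDet d fun i => normalize (x i + y) - normalize y) volume := by
  have : Nonempty (Fin d) := ⟨⟨0, hd⟩⟩
  -- The `2` bounds a chord, and `2 * ∑ ‖x i‖` bounds a chord times `‖y‖`; their sum bounds a chord
  -- times `1 + ‖y‖`.
  set K : ℝ := 2 + 2 * ∑ i, ‖x i‖ with hKdef
  have hK : 0 < K := by positivity
  have hv : ∀ y i, ‖normalize (x i + y) - normalize y‖ ≤ K / (1 + ‖y‖) := by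
    intro y i
    rw [le_div_iff₀ (by positivity), mul_add, mul_one]
    refine add_le_add ?_ ?_
    · refine (norm_sub_le _ _).trans ?_
      linarith [norm_normalize_le_one (x i + y), norm_normalize_le_one y]
    · refine (norm_normalize_sub_normalize_mul_le _ _).trans ?_
      rw [add_sub_cancel_right]
      gcongr
      exact Finset.single_le_sum (f := fun i => ‖x i‖) (fun _ _ => norm_nonneg _)
        (Finset.mem_univ i)
  have hint : Integrable (fun y : EuclideanSpace ℝ (Fin d) =>
      (d * (d.factorial * K ^ (d + 1))) * (1 + ‖y‖) ^ (-((d : ℝ) + 1))) volume :=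
    (integrable_one_add_norm (by simp)).const_mul _
  refine hint.mono' ?_ ?_
  · simpa using (measurable_euclideanDet_normalize_sub x 0).aestronglyMeasurable
  · have hne : ∀ᵐ y : EuclideanSpace ℝ (Fin d), y ∉ insert 0 (Set.range fun i => -x i) :=
      ((Set.finite_range _).insert 0).countable.ae_notMem _
    filter_upwards [hne] with y hy
    have hy0 : y ≠ 0 := fun e => hy (by simp [e])
    have hyx : ∀ i, x i + y ≠ 0 := fun i e => hy (Or.inr ⟨i, by
      simpa using (eq_neg_of_add_eq_zero_right e).symm⟩)
    refine (abs_euclideanDet_le_of_chords (K := K / (1 + ‖y‖)) (by positivity) _ (normalize y)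
      (norm_normalize_eq_one_iff.mpr hy0)
      (fun i => by rw [sub_add_cancel]; exact norm_normalize_eq_one_iff.mpr (hyx i))
      (hv y)).trans_eq ?_
    rw [div_pow, Real.rpow_neg (by positivity)]
    norm_cast
    ring

end DetNormalize

/-! ### Reflection symmetry and isotropic second moments -/

section DetNormalizeLimit

open NormedSpace Filter Topology

variable {d : ℕ}

theorem euclideanDet_normalize (v : Fin d → EuclideanSpace ℝ (Fin d)) :
    euclideanDet d (fun i => normalize (v i)) = (∏ i, ‖v i‖⁻¹) * euclideanDet d v :=
  (euclideanDet d).map_smul_univ _ _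

/-- The determinant is affine in the common translation `y`, and vanishes at `y = -x i`, where a row
is zero. -/
theorem exists_euclideanDet_add_const_eq (x : Fin d → EuclideanSpace ℝ (Fin d)) :
    ∃ β : EuclideanSpace ℝ (Fin d),
      (∀ y, euclideanDet d (fun i => x i + y) = euclideanDet d x + inner ℝ β y) ∧
      ∀ i, inner ℝ β (x i) = euclideanDet d x := by
  set L : EuclideanSpace ℝ (Fin d) →ₗ[ℝ] ℝ :=
    ∑ j, (euclideanDet d).toMultilinearMap.toLinearMap x j with hL
  have key : ∀ y, euclideanDet d (fun i => x i + y) = euclideanDet d x +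
      inner ℝ ((InnerProductSpace.toDual ℝ _).symm L.toContinuousLinearMap) y := by
    intro y
    rw [AlternatingMap.map_add_const, InnerProductSpace.toDual_symm_apply]
    simp [hL]
  refine ⟨_, key, fun i => ?_⟩
  have h := key (-x i)
  rw [(euclideanDet d).map_coord_zero i (by simp), inner_neg_right] at h
  linarith

/-- The hyperplane through the points `-x i` is a mirror under which the determinant is odd. -/
theorem integral_euclideanDet_normalize_mul_radial_eq_zero
    (x : Fin d → EuclideanSpace ℝ (Fin d)) (i₀ : Fin d) (h : ℝ → ℝ) :
    ∫ y, euclideanDet d (fun i => normalize (x i + y)) * h ‖x i₀ + y‖ = 0 := by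
  obtain ⟨β, hβ, hβx⟩ := exists_euclideanDet_add_const_eq x
  set G : EuclideanSpace ℝ (Fin d) → ℝ := fun z =>
    (∏ i, ‖(x i - x i₀) + z‖⁻¹) * inner ℝ β z * h ‖z‖ with hG
  have e1 : ∀ y, euclideanDet d (fun i => normalize (x i + y)) * h ‖x i₀ + y‖ = G (x i₀ + y) := by
    intro y
    simp only [hG]
    rw [euclideanDet_normalize, hβ, inner_add_right, hβx]
    simp only [← add_assoc, sub_add_cancel]
  simp_rw [e1]
  rw [integral_add_left_eq_self]
  -- With the origin moved to `-x i₀`, the mirror is `βᗮ`. It contains every `x i - x i₀`, so only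
  -- the factor `inner ℝ β z` changes sign.
  set ρ := ((Submodule.span ℝ {β})ᗮ).reflection with hρ
  have hρβ : ρ β = -β := Submodule.reflection_mem_subspace_orthogonalComplement_eq_neg (by
    rw [Submodule.orthogonal_orthogonal]; exact Submodule.mem_span_singleton_self β)
  have hρx : ∀ i, ρ (x i - x i₀) = x i - x i₀ := fun i =>
    Submodule.reflection_mem_subspace_eq_self (by
      rw [Submodule.mem_orthogonal_singleton_iff_inner_right, inner_sub_right, hβx, hβx, sub_self])
  have hodd : ∀ z, G (ρ z) = -G z := by
    intro z
    have a1 : ∀ i, ‖(x i - x i₀) + ρ z‖ = ‖(x i - x i₀) + z‖ := by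
      intro i
      rw [← ρ.norm_map ((x i - x i₀) + z), map_add, hρx]
    have a2 : inner ℝ β (ρ z) = -inner ℝ β z := by
      rw [← ρ.inner_map_map β z, hρβ, inner_neg_left, neg_neg]
    simp only [hG, a1, a2, ρ.norm_map]
    ring
  have hint := ρ.measurePreserving.integral_comp ρ.toHomeomorph.measurableEmbedding G
  have h2 : ∫ z, G (ρ z) = -∫ z, G z := by
    simp_rw [hodd]; exact integral_neg _
  have h3 : ∫ z, G z = -∫ z, G z := hint.symm.trans h2
  exact self_eq_neg.mp h3

/-- By reflections, mixed moments `u i * u j` vanish and all diagonal ones agree; the latter add up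
to the moment of `‖u‖²`. -/
theorem integral_inner_mul_inner_mul_radial (a b : EuclideanSpace ℝ (Fin d)) (g : ℝ → ℝ)
    (hg : Measurable g)
    (hint : Integrable (fun u : EuclideanSpace ℝ (Fin d) => ‖u‖ ^ 2 * g ‖u‖) volume) :
    d * ∫ u : EuclideanSpace ℝ (Fin d), inner ℝ a u * inner ℝ b u * g ‖u‖ =
      inner ℝ a b * ∫ u : EuclideanSpace ℝ (Fin d), ‖u‖ ^ 2 * g ‖u‖ := by
  set T : Fin d → Fin d → EuclideanSpace ℝ (Fin d) → ℝ := fun i j u => u i * u j * g ‖u‖ with hT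
  have hTi : ∀ i j, Integrable (T i j) volume := by
    intro i j
    refine hint.mono (by
      refine Measurable.aestronglyMeasurable ?_
      simp only [hT]
      fun_prop) (ae_of_all _ fun u => ?_)
    simp only [hT, norm_mul, norm_pow, norm_norm]
    have hi := PiLp.norm_apply_le u i
    have hj := PiLp.norm_apply_le u j
    rw [sq]
    gcongr
  have hchange : ∀ (ρ : EuclideanSpace ℝ (Fin d) ≃ₗᵢ[ℝ] EuclideanSpace ℝ (Fin d))
      (f : EuclideanSpace ℝ (Fin d) → ℝ), ∫ u, f (ρ u) = ∫ u, f u := fun ρ f =>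
    ρ.measurePreserving.integral_comp ρ.toHomeomorph.measurableEmbedding f
  have hcoord : ∀ (u : EuclideanSpace ℝ (Fin d)) i,
      u i = inner ℝ (EuclideanSpace.single i (1 : ℝ)) u := fun u i => by
    rw [EuclideanSpace.inner_single_left]; simp
  have hoff : ∀ i j, i ≠ j → ∫ u, T i j u = 0 := by
    intro i j hij
    set ei : EuclideanSpace ℝ (Fin d) := EuclideanSpace.single i (1 : ℝ) with hei
    set ρ := ((Submodule.span ℝ {ei})ᗮ).reflection
    have h1 : ρ ei = -ei := Submodule.reflection_mem_subspace_orthogonalComplement_eq_neg (by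
      rw [Submodule.orthogonal_orthogonal]; exact Submodule.mem_span_singleton_self _)
    have h2 : ρ (EuclideanSpace.single j (1 : ℝ)) = EuclideanSpace.single j (1 : ℝ) :=
      Submodule.reflection_mem_subspace_eq_self (by
        rw [Submodule.mem_orthogonal_singleton_iff_inner_right]
        rw [hei, EuclideanSpace.inner_single_left]
        simp [hij])
    have h3 : ∀ u, T i j (ρ u) = -T i j u := by
      intro u
      simp only [hT]
      rw [hcoord (ρ u) i, hcoord (ρ u) j, hcoord u i, hcoord u j, ρ.norm_map,
        ← ρ.inner_map_map _ u, ← ρ.inner_map_map _ u, h2, ← hei, h1, inner_neg_left]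
      ring
    have h4 : ∫ u, T i j u = -∫ u, T i j u := by
      rw [← integral_neg, ← hchange ρ]; simp_rw [h3]
    exact self_eq_neg.mp h4
  have hdiag : ∀ i j, ∫ u, T i i u = ∫ u, T j j u := by
    intro i j
    set ρ := ((Submodule.span ℝ {(EuclideanSpace.single j (1 : ℝ) : EuclideanSpace ℝ (Fin d))
      - EuclideanSpace.single i (1 : ℝ)})ᗮ).reflection
    have h1 : ρ (EuclideanSpace.single j (1 : ℝ)) = EuclideanSpace.single i (1 : ℝ) :=
      Submodule.reflection_sub (by simp)
    rw [← hchange ρ]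
    congr 1
    ext u
    simp only [hT]
    rw [hcoord (ρ u) i, hcoord u j, ρ.norm_map, ← h1, ρ.inner_map_map]
  have hsum : ∑ i, ∫ u, T i i u = ∫ u : EuclideanSpace ℝ (Fin d), ‖u‖ ^ 2 * g ‖u‖ := by
    rw [← integral_finsetSum _ fun i _ => hTi i i]
    congr 1
    ext u
    simp only [hT]
    rw [EuclideanSpace.real_norm_sq_eq, Finset.sum_mul]
    exact Finset.sum_congr rfl fun i _ => by rw [sq]
  have hc : ∀ i, d * ∫ u, T i i u = ∫ u : EuclideanSpace ℝ (Fin d), ‖u‖ ^ 2 * g ‖u‖ := by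
    intro i
    rw [← hsum, Finset.sum_congr rfl fun j _ => hdiag j i]
    simp
  have hexp : ∀ u : EuclideanSpace ℝ (Fin d), inner ℝ a u * inner ℝ b u * g ‖u‖
      = ∑ i, ∑ j, a i * b j * T i j u := by
    intro u
    rw [PiLp.inner_apply, PiLp.inner_apply, Finset.sum_mul_sum, Finset.sum_mul]
    refine Finset.sum_congr rfl fun i _ => ?_
    rw [Finset.sum_mul]
    refine Finset.sum_congr rfl fun j _ => ?_
    simp only [hT, RCLike.inner_apply, conj_trivial]
    ring
  simp_rw [hexp]
  rw [integral_finsetSum _ fun i _ => integrable_finsetSum _ fun j _ => (hTi i j).const_mul _]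
  simp_rw [integral_finsetSum _ fun j _ => (hTi _ j).const_mul _, integral_const_mul]
  rw [PiLp.inner_apply, Finset.sum_mul, Finset.mul_sum]
  refine Finset.sum_congr rfl fun i _ => ?_
  rw [Finset.sum_eq_single i (fun j _ hj => by rw [hoff i j hj.symm, mul_zero]) (by simp), ← hc i]
  simp only [RCLike.inner_apply, conj_trivial]
  ring

end DetNormalizeLimit

/-! ### The smooth cutoff and its limiting weight -/

section RadialCutoff

open NormedSpace Filter Topology

/-- A smooth function equal to `1` on `(-∞, 1]` and to `0` on `[2, ∞)`. -/
noncomputable def cutoff (t : ℝ) : ℝ := Real.smoothTransition (2 - t)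

theorem contDiff_cutoff : ContDiff ℝ 1 cutoff :=
  Real.smoothTransition.contDiff.comp (contDiff_const.sub contDiff_id)

theorem cutoff_of_le_one {t : ℝ} (h : t ≤ 1) : cutoff t = 1 :=
  Real.smoothTransition.one_of_one_le (by linarith)

theorem cutoff_of_two_le {t : ℝ} (h : 2 ≤ t) : cutoff t = 0 :=
  Real.smoothTransition.zero_of_nonpos (by linarith)

theorem abs_cutoff_le_one (t : ℝ) : |cutoff t| ≤ 1 := by
  unfold cutoff
  rw [abs_of_nonneg (Real.smoothTransition.nonneg _)]
  exact Real.smoothTransition.le_one _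

theorem hasDerivAt_cutoff (t : ℝ) : HasDerivAt cutoff (deriv cutoff t) t :=
  (contDiff_cutoff.differentiable one_ne_zero t).hasDerivAt

theorem continuous_deriv_cutoff : Continuous (deriv cutoff) :=
  contDiff_cutoff.continuous_deriv le_rfl

theorem deriv_cutoff_of_lt_one {t : ℝ} (h : t < 1) : deriv cutoff t = 0 := by
  have : cutoff =ᶠ[𝓝 t] fun _ => 1 := by
    filter_upwards [Iio_mem_nhds h] with s hs using cutoff_of_le_one (le_of_lt hs)
  rw [this.deriv_eq, deriv_const]

theorem deriv_cutoff_of_two_lt {t : ℝ} (h : 2 < t) : deriv cutoff t = 0 := by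
  have : cutoff =ᶠ[𝓝 t] fun _ => 0 := by
    filter_upwards [Ioi_mem_nhds h] with s hs using cutoff_of_two_le (le_of_lt hs)
  rw [this.deriv_eq, deriv_const]

theorem exists_abs_deriv_cutoff_le : ∃ M, 0 ≤ M ∧ ∀ t, |deriv cutoff t| ≤ M := by
  obtain ⟨M, hM⟩ := (isCompact_Icc (a := (1 : ℝ)) (b := 2)).exists_bound_of_continuousOn
    continuous_deriv_cutoff.continuousOn
  refine ⟨M, (norm_nonneg _).trans (hM 1 (by norm_num)), fun t => ?_⟩
  have hM0 : 0 ≤ M := (norm_nonneg _).trans (hM 1 (by norm_num))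
  rcases lt_or_ge t 1 with h | h
  · simpa [deriv_cutoff_of_lt_one h] using hM0
  rcases lt_or_ge 2 t with h' | h'
  · simpa [deriv_cutoff_of_two_lt h'] using hM0
  · exact hM t ⟨h, h'⟩

theorem integral_Ioi_deriv_cutoff_sq :
    ∫ r in Set.Ioi (0 : ℝ), -2 * r * deriv cutoff (r ^ 2) = 1 := by
  have hcont : Continuous fun r : ℝ => -2 * r * deriv cutoff (r ^ 2) := by
    have := continuous_deriv_cutoff
    fun_prop
  have hsupp : HasCompactSupport fun r : ℝ => -2 * r * deriv cutoff (r ^ 2) := by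
    refine HasCompactSupport.intro (isCompact_Icc (a := (-2 : ℝ)) (b := 2)) fun r hr => ?_
    rw [deriv_cutoff_of_two_lt, mul_zero]
    have : ¬ |r| ≤ 2 := fun h => hr (abs_le.mp h)
    nlinarith [sq_abs r, abs_nonneg r]
  have hder : ∀ r : ℝ, HasDerivAt (fun r => -cutoff (r ^ 2)) (-2 * r * deriv cutoff (r ^ 2)) r := by
    intro r
    have := ((hasDerivAt_cutoff (r ^ 2)).comp r (hasDerivAt_pow 2 r)).neg
    exact this.congr_deriv (by push_cast; ring)
  have hlim : Tendsto (fun r : ℝ => -cutoff (r ^ 2)) atTop (𝓝 0) := by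
    refine tendsto_const_nhds.congr' ?_
    filter_upwards [eventually_ge_atTop 2] with r hr
    rw [cutoff_of_two_le (by nlinarith), neg_zero]
  rw [integral_Ioi_of_hasDerivAt_of_tendsto (hder 0).continuousAt.continuousWithinAt
    (fun r _ => hder r) (hcont.integrable_of_hasCompactSupport hsupp).integrableOn hlim]
  rw [cutoff_of_le_one (by norm_num)]
  norm_num

variable {d : ℕ}

theorem contDiff_cutoff_norm_sq :
    ContDiff ℝ 1 fun u : EuclideanSpace ℝ (Fin d) => cutoff (‖u‖ ^ 2) :=
  contDiff_cutoff.comp (contDiff_norm_sq ℝ)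

theorem hasCompactSupport_cutoff_norm_sq :
    HasCompactSupport fun u : EuclideanSpace ℝ (Fin d) => cutoff (‖u‖ ^ 2) := by
  refine HasCompactSupport.intro (isCompact_closedBall 0 2) fun u hu => ?_
  refine cutoff_of_two_le ?_
  have : ¬ ‖u‖ ≤ 2 := fun h => hu (by simpa using h)
  nlinarith

theorem hasDerivAt_cutoff_norm_sq_line (a u : EuclideanSpace ℝ (Fin d)) :
    HasDerivAt (fun s : ℝ => cutoff (‖s • a + u‖ ^ 2))
      (deriv cutoff (‖u‖ ^ 2) * (2 * inner ℝ u a)) 0 := by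
  have h1 : HasDerivAt (fun s : ℝ => s • a + u) a 0 := by
    simpa using ((hasDerivAt_id (0 : ℝ)).smul_const a).add_const u
  have h2 := h1.norm_sq
  have h3 := (hasDerivAt_cutoff (‖(0 : ℝ) • a + u‖ ^ 2)).comp (0 : ℝ) h2
  exact h3.congr_deriv (by simp)

/-- The weight `-2 |u|^{-d} φ'(|u|²)` arising in the limit of the translated cutoffs. -/
noncomputable def cutoffWeight (d : ℕ) (r : ℝ) : ℝ := r⁻¹ ^ d * (-2 * deriv cutoff (r ^ 2))

theorem measurable_cutoffWeight : Measurable (cutoffWeight d) := by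
  unfold cutoffWeight
  have := continuous_deriv_cutoff.measurable
  fun_prop

/-- The derivative of the cutoff vanishes for `‖u‖ < 1`, which removes the singularity of
`‖u‖^{-d}`, and for `‖u‖ > 2`. -/
theorem integrable_norm_sq_mul_cutoffWeight :
    Integrable (fun u : EuclideanSpace ℝ (Fin d) => ‖u‖ ^ 2 * cutoffWeight d ‖u‖) volume := by
  obtain ⟨M, hM0, hM⟩ := exists_abs_deriv_cutoff_le
  have hi : Integrable (Set.indicator (Metric.closedBall (0 : EuclideanSpace ℝ (Fin d)) 2)
      fun _ => 4 * (1 * (2 * M))) volume :=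
    (continuousOn_const.integrableOn_compact (isCompact_closedBall _ _)).integrable_indicator
      measurableSet_closedBall
  refine hi.mono' ?_ (ae_of_all _ fun u => ?_)
  · have := measurable_cutoffWeight (d := d)
    exact Measurable.aestronglyMeasurable (by fun_prop)
  · by_cases hu : ‖u‖ ≤ 2
    · rw [Set.indicator_of_mem (by simpa using hu)]
      rw [norm_mul, norm_pow, norm_norm]
      have h0 : ‖u‖ ^ 2 ≤ 4 := by nlinarith [norm_nonneg u]
      have h1 : ‖cutoffWeight d ‖u‖‖ ≤ 1 * (2 * M) := by
        unfold cutoffWeight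
        rcases lt_or_ge ‖u‖ 1 with h | h
        · rw [deriv_cutoff_of_lt_one (by nlinarith [norm_nonneg u])]
          simpa using hM0
        · rw [norm_mul, norm_mul]
          have h2 : ‖‖u‖⁻¹ ^ d‖ ≤ 1 := by
            rw [norm_pow, norm_inv, norm_norm]
            exact pow_le_one₀ (by positivity) (inv_le_one_of_one_le₀ h)
          have h3 : ‖(-2 : ℝ)‖ = 2 := by norm_num
          rw [h3]
          gcongr
          exact hM _
      gcongr
    · rw [Set.indicator_of_notMem (by simpa using hu)]
      unfold cutoffWeight
      rw [deriv_cutoff_of_two_lt (by nlinarith)]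
      simp

/-- In polar coordinates the powers of `r` combine to `r`, leaving the exact derivative of `-cutoff
(r ^ 2)`, whose integral is `1`. -/
theorem integral_norm_sq_mul_cutoffWeight (hd : 0 < d) :
    ∫ u : EuclideanSpace ℝ (Fin d), ‖u‖ ^ 2 * cutoffWeight d ‖u‖ =
      d * volume.real (Metric.ball (0 : EuclideanSpace ℝ (Fin d)) 1) := by
  have : Nonempty (Fin d) := ⟨⟨0, hd⟩⟩
  rw [integral_fun_norm_addHaar volume fun r => r ^ 2 * cutoffWeight d r]
  have h : ∫ r in Set.Ioi (0 : ℝ), r ^ (d - 1) • (r ^ 2 * cutoffWeight d r) = 1 := by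
    rw [← integral_Ioi_deriv_cutoff_sq]
    refine setIntegral_congr_fun measurableSet_Ioi fun r hr => ?_
    have hr' : r ≠ 0 := ne_of_gt hr
    obtain ⟨n, rfl⟩ := Nat.exists_eq_succ_of_ne_zero hd.ne'
    simp only [cutoffWeight, smul_eq_mul, inv_pow, Nat.succ_eq_add_one, Nat.add_sub_cancel]
    field_simp
    ring
  rw [finrank_euclideanSpace_fin, h]
  simp

end RadialCutoff

/-! ### The regularized integral and its limit -/

section RegularizedIntegral

open NormedSpace Filter Topology

variable {d : ℕ}

theorem integrable_euclideanDet_normalize_mul (x : Fin d → EuclideanSpace ℝ (Fin d))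
    {k : EuclideanSpace ℝ (Fin d) → ℝ} (hk : Integrable k volume) :
    Integrable (fun y => euclideanDet d (fun i => normalize (x i + y)) * k y) volume :=
  hk.bdd_mul (c := d.factorial * 1 ^ d) (measurable_euclideanDet_normalize x).aestronglyMeasurable
    (ae_of_all _ fun _ => abs_euclideanDet_le _ fun _ => norm_normalize_le_one _)

theorem integrable_cutoff_norm_sq_smul_add {s : ℝ} (hs : s ≠ 0)
    (a : EuclideanSpace ℝ (Fin d)) :
    Integrable (fun y : EuclideanSpace ℝ (Fin d) => cutoff (‖s • (a + y)‖ ^ 2)) volume := by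
  have h := contDiff_cutoff_norm_sq.continuous.integrable_of_hasCompactSupport
    (μ := volume) (hasCompactSupport_cutoff_norm_sq (d := d))
  exact (h.comp_smul hs).comp_add_left a

/-- The rescaled integrand of the difference between the cutoffs centred at `0` and at `-x i₀`. -/
theorem integral_euclideanDet_normalize_mul_cutoff_eq (x : Fin d → EuclideanSpace ℝ (Fin d))
    (i₀ : Fin d) {β : EuclideanSpace ℝ (Fin d)}
    (hβ : ∀ y, euclideanDet d (fun i => x i + y) = euclideanDet d x + inner ℝ β y)
    {s : ℝ} (hs : 0 < s) :
    ∫ y, euclideanDet d (fun i => normalize (x i + y)) * cutoff (‖s • y‖ ^ 2) =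
      ∫ u, (s * euclideanDet d x + inner ℝ β u) * (∏ i, ‖s • x i + u‖⁻¹) *
        (s⁻¹ * (cutoff (‖u‖ ^ 2) - cutoff (‖s • x i₀ + u‖ ^ 2))) := by
  have h0 := integral_euclideanDet_normalize_mul_radial_eq_zero x i₀
    fun r => cutoff ((|s| * r) ^ 2)
  have h1 : ∀ y : EuclideanSpace ℝ (Fin d), |s| * ‖x i₀ + y‖ = ‖s • (x i₀ + y)‖ := fun y => by
    rw [norm_smul, Real.norm_eq_abs]
  simp only [h1] at h0
  have hi1 := integrable_euclideanDet_normalize_mul x (integrable_cutoff_norm_sq_smul_add hs.ne' 0)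
  have hi2 := integrable_euclideanDet_normalize_mul x
    (integrable_cutoff_norm_sq_smul_add hs.ne' (x i₀))
  simp only [zero_add] at hi1
  -- Subtract the vanishing integral whose cutoff is centred at `-x i₀`.
  rw [← sub_zero (∫ y, _ * cutoff (‖s • y‖ ^ 2)), ← h0, ← integral_sub hi1 hi2]
  have hcv := Measure.integral_comp_inv_smul (volume : Measure (EuclideanSpace ℝ (Fin d)))
    (fun y => euclideanDet d (fun i => normalize (x i + y)) * cutoff (‖s • y‖ ^ 2) -
      euclideanDet d (fun i => normalize (x i + y)) * cutoff (‖s • (x i₀ + y)‖ ^ 2)) s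
  rw [finrank_euclideanSpace_fin, abs_of_pos (by positivity), smul_eq_mul] at hcv
  rw [← mul_right_inj' (pow_pos hs d).ne', ← hcv, ← integral_const_mul]
  congr 1
  ext u
  -- With `y = s⁻¹ • u`, these `d` factors `s` cancel the Jacobian; the `s⁻¹` taken out of the
  -- affine numerator makes a difference quotient of the cutoffs.
  have hn : ∀ i, ‖x i + s⁻¹ • u‖⁻¹ = s * ‖s • x i + u‖⁻¹ := by
    intro i
    have : s • x i + u = s • (x i + s⁻¹ • u) := by rw [smul_add, smul_inv_smul₀ hs.ne']
    rw [this, norm_smul, Real.norm_eq_abs, abs_of_pos hs, mul_inv, mul_inv_cancel_left₀ hs.ne']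
  rw [euclideanDet_normalize, hβ, inner_smul_right, smul_add, smul_inv_smul₀ hs.ne']
  simp only [hn, Finset.prod_mul_distrib, Finset.prod_const, Finset.card_univ, Fintype.card_fin]
  field_simp

/-- The difference quotient tends to a directional derivative along `x i₀`, so the limit integrand
is `inner ℝ β u * inner ℝ (x i₀) u` times a radial weight. The second-moment formula then yields
`inner ℝ β (x i₀) = det x`. -/
theorem tendsto_integral_euclideanDet_normalize_mul_cutoff (hd : 0 < d)
    (x : Fin d → EuclideanSpace ℝ (Fin d)) :
    Tendsto (fun s : ℝ => ∫ y, euclideanDet d (fun i => normalize (x i + y)) *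
        cutoff (‖s • y‖ ^ 2)) (𝓝[>] 0)
      (𝓝 (volume.real (Metric.ball (0 : EuclideanSpace ℝ (Fin d)) 1) * euclideanDet d x)) := by
  set i₀ : Fin d := ⟨0, hd⟩
  obtain ⟨β, hβ, hβx⟩ := exists_euclideanDet_add_const_eq x
  obtain ⟨L, hL⟩ := contDiff_cutoff_norm_sq.lipschitzWith_of_hasCompactSupport
    (hasCompactSupport_cutoff_norm_sq (d := d)) one_ne_zero
  have hne : Nonempty (Fin d) := ⟨i₀⟩
  have hlim : ∫ u : EuclideanSpace ℝ (Fin d), inner ℝ β u * inner ℝ (x i₀) u * cutoffWeight d ‖u‖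
      = volume.real (Metric.ball (0 : EuclideanSpace ℝ (Fin d)) 1) * euclideanDet d x := by
    have h := integral_inner_mul_inner_mul_radial β (x i₀) (cutoffWeight d)
      measurable_cutoffWeight integrable_norm_sq_mul_cutoffWeight
    rw [integral_norm_sq_mul_cutoffWeight hd, hβx] at h
    have hd' : (d : ℝ) ≠ 0 := by exact_mod_cast hd.ne'
    apply mul_left_cancel₀ hd'
    rw [h]; ring
  rw [← hlim]
  have hcongr : (fun s : ℝ => ∫ u, (s * euclideanDet d x + inner ℝ β u) *
        (∏ i, ‖s • x i + u‖⁻¹) * (s⁻¹ * (cutoff (‖u‖ ^ 2) - cutoff (‖s • x i₀ + u‖ ^ 2))))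
      =ᶠ[𝓝[>] 0] fun s : ℝ => ∫ y, euclideanDet d (fun i => normalize (x i + y)) *
        cutoff (‖s • y‖ ^ 2) := by
    filter_upwards [self_mem_nhdsWithin] with s hs
    exact (integral_euclideanDet_normalize_mul_cutoff_eq x i₀ hβ hs).symm
  refine Tendsto.congr' hcongr ?_
  set X : ℝ := ∑ i, ‖x i‖ with hX
  have hxX : ∀ i, ‖x i‖ ≤ X := fun i =>
    Finset.single_le_sum (f := fun i => ‖x i‖) (fun _ _ => norm_nonneg _) (Finset.mem_univ i)
  have hX0 : 0 ≤ X := Finset.sum_nonneg fun _ _ => norm_nonneg _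
  -- Once `s * X < 1/4`, both cutoffs equal `1` for `‖u‖ < 1/2` and `0` for `‖u‖ > 3`. In between,
  -- each `‖s • x i + u‖` is at least `1/4`, whence `4 ^ d`; `L * X` bounds the difference quotient.
  set C : ℝ := (|euclideanDet d x| + ‖β‖ * 3) * 4 ^ d * (L * X) with hC
  have hC0 : 0 ≤ C := by positivity
  refine tendsto_integral_filter_of_dominated_convergence
    (Set.indicator (Metric.closedBall 0 3) fun _ => C) ?_ ?_ ?_ ?_
  · refine Eventually.of_forall fun s => Measurable.aestronglyMeasurable ?_
    have := contDiff_cutoff.continuous.measurable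
    fun_prop
  · have hsmall : ∀ᶠ s : ℝ in 𝓝[>] 0, s * X < 1 / 4 := by
      have : Tendsto (fun s : ℝ => s * X) (𝓝[>] 0) (𝓝 0) := by
        have hc : Continuous fun s : ℝ => s * X := by fun_prop
        exact (hc.tendsto' 0 0 (zero_mul X)).mono_left nhdsWithin_le_nhds
      exact this.eventually (Iio_mem_nhds (by norm_num))
    have hone : ∀ᶠ s : ℝ in 𝓝[>] 0, s < 1 :=
      nhdsWithin_le_nhds (Iio_mem_nhds zero_lt_one)
    filter_upwards [hsmall, hone, self_mem_nhdsWithin] with s hs hs1 hs0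
    have hs0 : 0 < s := hs0
    refine ae_of_all _ fun u => ?_
    have hsx : ∀ i, ‖s • x i‖ ≤ 1 / 4 := fun i => by
      rw [norm_smul, Real.norm_eq_abs, abs_of_pos hs0]
      exact (mul_le_mul_of_nonneg_left (hxX i) hs0.le).trans hs.le
    have hlow : ∀ i, ‖u‖ - 1 / 4 ≤ ‖s • x i + u‖ := fun i => by
      have := norm_sub_norm_le u (-(s • x i))
      rw [norm_neg, sub_neg_eq_add, add_comm u] at this
      linarith [hsx i]
    have hup : ∀ i, ‖s • x i + u‖ ≤ 1 / 4 + ‖u‖ := fun i =>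
      (norm_add_le _ _).trans (by linarith [hsx i])
    by_cases hu3 : ‖u‖ ≤ 3
    · rw [Set.indicator_of_mem (by simpa using hu3)]
      by_cases hu : ‖u‖ < 1 / 2
      · rw [cutoff_of_le_one (by nlinarith [norm_nonneg u]),
          cutoff_of_le_one (by nlinarith [hup i₀, norm_nonneg (s • x i₀ + u)])]
        simpa using hC0
      · have hprod : ‖∏ i, ‖s • x i + u‖⁻¹‖ ≤ 4 ^ d := by
          rw [norm_prod]
          calc ∏ i, ‖‖s • x i + u‖⁻¹‖ ≤ ∏ _i : Fin d, (4 : ℝ) := by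
                refine Finset.prod_le_prod (fun _ _ => norm_nonneg _) fun i _ => ?_
                rw [norm_inv, norm_norm]
                refine inv_le_of_inv_le₀ (by norm_num) ?_
                linarith [hlow i]
            _ = 4 ^ d := by simp
        have hnum : ‖s * euclideanDet d x + inner ℝ β u‖ ≤ |euclideanDet d x| + ‖β‖ * 3 := by
          refine (norm_add_le _ _).trans (add_le_add ?_ ?_)
          · rw [norm_mul, Real.norm_eq_abs, Real.norm_eq_abs, abs_of_pos hs0]
            exact mul_le_of_le_one_left (abs_nonneg _) hs1.le
          · exact (norm_inner_le_norm _ _).trans (by gcongr)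
        have hquot : ‖s⁻¹ * (cutoff (‖u‖ ^ 2) - cutoff (‖s • x i₀ + u‖ ^ 2))‖ ≤ L * X := by
          have h := hL.dist_le_mul u (s • x i₀ + u)
          rw [dist_eq_norm, dist_eq_norm, ← norm_neg (u - _), neg_sub, add_sub_cancel_right,
            norm_smul, Real.norm_eq_abs s, abs_of_pos hs0] at h
          rw [norm_mul, norm_inv, Real.norm_eq_abs s, abs_of_pos hs0, inv_mul_le_iff₀ hs0]
          refine h.trans ?_
          calc (L : ℝ) * (s * ‖x i₀‖) ≤ L * (s * X) := by gcongr; exact hxX i₀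
            _ = s * (L * X) := by ring
        rw [norm_mul, norm_mul, hC]
        gcongr
    · rw [Set.indicator_of_notMem (by simpa using hu3)]
      rw [cutoff_of_two_le (by nlinarith), cutoff_of_two_le (by nlinarith [hlow i₀])]
      simp
  · exact (continuousOn_const.integrableOn_compact (isCompact_closedBall _ _)).integrable_indicator
      measurableSet_closedBall
  · have hne0 : ∀ᵐ u : EuclideanSpace ℝ (Fin d), u ≠ 0 :=
      (Set.countable_singleton 0).ae_notMem _
    filter_upwards [hne0] with u hu
    have hu' : ‖u‖ ≠ 0 := norm_ne_zero_iff.mpr hu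
    have t1 : Tendsto (fun s : ℝ => s * euclideanDet d x + inner ℝ β u) (𝓝[>] 0)
        (𝓝 (inner ℝ β u)) := by
      have : Continuous fun s : ℝ => s * euclideanDet d x + inner ℝ β u := by fun_prop
      exact (this.tendsto' 0 _ (by simp)).mono_left nhdsWithin_le_nhds
    have t2 : Tendsto (fun s : ℝ => ∏ i, ‖s • x i + u‖⁻¹) (𝓝[>] 0) (𝓝 (‖u‖⁻¹ ^ d)) := by
      have : Tendsto (fun s : ℝ => ∏ i, ‖s • x i + u‖⁻¹) (𝓝[>] 0) (𝓝 (∏ _i : Fin d, ‖u‖⁻¹)) := by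
        refine tendsto_finsetProd _ fun i _ => Tendsto.inv₀ ?_ hu'
        have : Continuous fun s : ℝ => ‖s • x i + u‖ := by fun_prop
        exact (this.tendsto' 0 _ (by simp)).mono_left nhdsWithin_le_nhds
      simpa using this
    have t3 : Tendsto (fun s : ℝ => s⁻¹ * (cutoff (‖u‖ ^ 2) - cutoff (‖s • x i₀ + u‖ ^ 2)))
        (𝓝[>] 0) (𝓝 (-(deriv cutoff (‖u‖ ^ 2) * (2 * inner ℝ u (x i₀))))) := by
      have h := (hasDerivAt_iff_tendsto_slope_zero.mp
        (hasDerivAt_cutoff_norm_sq_line (x i₀) u)).neg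
      refine (h.mono_left (nhdsWithin_mono _ fun s hs => ne_of_gt hs)).congr fun s => ?_
      simp only [zero_add, zero_smul, smul_eq_mul]
      ring
    convert (t1.mul t2).mul t3 using 2
    rw [real_inner_comm u (x i₀)]
    unfold cutoffWeight
    ring

theorem integral_euclideanDet_normalize_sub (hd : 0 < d)
    (x : Fin d → EuclideanSpace ℝ (Fin d)) :
    ∫ y, euclideanDet d (fun i => normalize (x i + y) - normalize y) =
      volume.real (Metric.ball (0 : EuclideanSpace ℝ (Fin d)) 1) * euclideanDet d x := by
  have hF := integrable_euclideanDet_normalize_sub hd x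
  set V := volume.real (Metric.ball (0 : EuclideanSpace ℝ (Fin d)) 1)
  have lim1 : Tendsto (fun s : ℝ => ∫ y, euclideanDet d
      (fun i => normalize (x i + y) - normalize y) * cutoff (‖s • y‖ ^ 2)) (𝓝[>] 0)
      (𝓝 (∫ y, euclideanDet d (fun i => normalize (x i + y) - normalize y))) := by
    refine tendsto_integral_filter_of_dominated_convergence _ ?_ ?_ hF.norm ?_
    · refine Eventually.of_forall fun s => hF.aestronglyMeasurable.mul ?_
      have := contDiff_cutoff.continuous.measurable
      exact Measurable.aestronglyMeasurable (by fun_prop)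
    · refine Eventually.of_forall fun s => ae_of_all _ fun y => ?_
      rw [norm_mul]
      exact mul_le_of_le_one_right (norm_nonneg _) (abs_cutoff_le_one _)
    · refine ae_of_all _ fun y => ?_
      have hc : Continuous fun s : ℝ => euclideanDet d
          (fun i => normalize (x i + y) - normalize y) * cutoff (‖s • y‖ ^ 2) := by
        have := contDiff_cutoff.continuous
        fun_prop
      exact (hc.tendsto' 0 _ (by simp [cutoff_of_le_one])).mono_left nhdsWithin_le_nhds
  -- A row `normalize y` is the row of a family whose `j`-th point is `0`, so every term has the
  -- same form.
  have hexp : ∀ y, euclideanDet d (fun i => normalize (x i + y) - normalize y) =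
      euclideanDet d (fun i => normalize (x i + y)) -
        ∑ j, euclideanDet d (fun i => normalize (Function.update x j 0 i + y)) := by
    intro y
    simp_rw [sub_eq_add_neg]
    rw [AlternatingMap.map_add_const, ← Finset.sum_neg_distrib]
    congr 1
    refine Finset.sum_congr rfl fun j _ => ?_
    rw [(euclideanDet d).map_update_neg]
    congr 2
    ext1 i
    by_cases h : i = j
    · subst h; simp
    · simp [h]
  have lim2 : Tendsto (fun s : ℝ => ∫ y, euclideanDet d
      (fun i => normalize (x i + y) - normalize y) * cutoff (‖s • y‖ ^ 2)) (𝓝[>] 0)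
      (𝓝 (V * euclideanDet d x - ∑ j, V * euclideanDet d (Function.update x j 0))) := by
    refine ((tendsto_integral_euclideanDet_normalize_mul_cutoff hd x).sub
      (tendsto_finsetSum _ fun j _ => tendsto_integral_euclideanDet_normalize_mul_cutoff hd
        (Function.update x j 0))).congr' ?_
    filter_upwards [self_mem_nhdsWithin] with s hs
    have hi : ∀ z : Fin d → EuclideanSpace ℝ (Fin d), Integrable (fun y =>
        euclideanDet d (fun i => normalize (z i + y)) * cutoff (‖s • y‖ ^ 2)) volume := fun z => by
      simpa using integrable_euclideanDet_normalize_mul z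
        (integrable_cutoff_norm_sq_smul_add (ne_of_gt hs) 0)
    rw [← integral_finsetSum _ fun j _ => hi _,
      ← integral_sub (hi x) (integrable_finsetSum _ fun j _ => hi _)]
    simp_rw [hexp, sub_mul, Finset.sum_mul]
  have h0 : ∀ j, euclideanDet d (Function.update x j 0) = 0 := fun j =>
    (euclideanDet d).map_coord_zero j (by simp)
  simpa [h0] using tendsto_nhds_unique lim1 lim2

end RegularizedIntegral

/-! ### Ball volume and conclusion -/

theorem volume_real_ball_euclideanSpace_odd (n : ℕ) :
    volume.real (Metric.ball (0 : EuclideanSpace ℝ (Fin (2 * n + 1))) 1) =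
      2 ^ (n + 1) * Real.pi ^ n / (Nat.doubleFactorial (2 * n + 1) : ℝ) := by
  have hG : Real.Gamma (((2 * n + 1 : ℕ) : ℝ) / 2 + 1) =
      (Nat.doubleFactorial (2 * n + 1) : ℝ) * √Real.pi / 2 ^ (n + 1) := by
    have := Real.Gamma_nat_add_half (n + 1)
    rw [show 2 * (n + 1) - 1 = 2 * n + 1 by omega] at this
    rw [← this]
    congr 1
    push_cast
    ring
  have hpi : √Real.pi ^ (2 * n + 1) = Real.pi ^ n * √Real.pi := by
    rw [pow_succ, pow_mul, Real.sq_sqrt Real.pi_pos.le]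
  have hs : √Real.pi ≠ 0 := (Real.sqrt_pos.mpr Real.pi_pos).ne'
  have hf : (Nat.doubleFactorial (2 * n + 1) : ℝ) ≠ 0 := by
    exact_mod_cast (Nat.doubleFactorial_pos _).ne'
  rw [Measure.real, EuclideanSpace.volume_ball, Fintype.card_fin, hG, hpi]
  simp only [ENNReal.ofReal_one, one_pow, one_mul]
  rw [ENNReal.toReal_ofReal (by positivity)]
  field_simp

theorem mainTheorem3 (d : ℕ) (hd : Odd d)
    (σ : Fin d → Matrix (Fin (2 ^ ((d - 1) / 2))) (Fin (2 ^ ((d - 1) / 2))) ℂ)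
    (hσ : IsCliffordGenerators d σ)
    (x : Fin (d + 1) → EuclideanSpace ℝ (Fin d)) (hx : x (Fin.last d) = 0) :
    Integrable (fun y : EuclideanSpace ℝ (Fin d) => cliffordIntegrand σ x y) volume ∧
    ∫ y : EuclideanSpace ℝ (Fin d), cliffordIntegrand σ x y =
      (2 ^ d * (-Complex.I * (Real.pi : ℂ)) ^ ((d - 1) / 2) / (Nat.doubleFactorial d : ℂ)) *
        ∑ ρ : Equiv.Perm (Fin d),
          ((Equiv.Perm.sign ρ : ℤ) : ℂ) * ∏ i : Fin d, ((x i.castSucc (ρ i) : ℝ) : ℂ) := by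
  have hpos : 0 < d := hd.pos
  have hpt : ∀ y, cliffordIntegrand σ x y = (-2 * Complex.I) ^ ((d - 1) / 2) *
      ((euclideanDet d (fun i => NormedSpace.normalize (x i.castSucc + y) -
        NormedSpace.normalize y) : ℝ) : ℂ) := by
    intro y
    have h := euclideanDet_sub_succ fun i => NormedSpace.normalize (x i + y)
    simp only [hx, zero_add] at h
    rw [cliffordIntegrand, hσ.trace_prod_sigmaDot hd, ← h, euclideanDet_apply]
  have hdet : ((euclideanDet d (fun i => x i.castSucc) : ℝ) : ℂ) =
      ∑ ρ : Equiv.Perm (Fin d),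
        ((Equiv.Perm.sign ρ : ℤ) : ℂ) * ∏ i : Fin d, ((x i.castSucc (ρ i) : ℝ) : ℂ) := by
    rw [euclideanDet_apply, ← Matrix.det_transpose, Matrix.det_apply']
    push_cast
    simp [Matrix.transpose_apply]
  simp_rw [hpt]
  refine ⟨(integrable_euclideanDet_normalize_sub hpos _).ofReal.const_mul _, ?_⟩
  rw [integral_const_mul, integral_complex_ofReal,
    integral_euclideanDet_normalize_sub hpos fun i => x i.castSucc, ← hdet]
  obtain ⟨n, rfl⟩ := hd
  -- The power of two is `2 ^ n` from the trace times `2 ^ (n + 1)` from the ball, that is `2 ^ d`.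
  rw [volume_real_ball_euclideanSpace_odd, show (2 * n + 1 - 1) / 2 = n by omega]
  push_cast
  rw [mul_pow, mul_pow, neg_pow Complex.I, neg_pow (2 : ℂ)]
  ring
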